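/- For an ordinal $\alpha$ let $2^{<\alpha}$ (resp. $2^{\le\alpha}$) be the set of all functions from some ordinal $\beta<\alpha$ (resp. $\beta\le\alpha$) to $2=\{0,1\}$, ordered by $s\le t\iff s\subseteq t$. A tree $T\subseteq 2^{<\alpha}$ is a downward closed subset of $2^{<\alpha}$; its levels are the sets $\{t\in T: \operatorname{dom}(t)=\beta\}$, its branches are its maximal chains, and the Cantor tree is $2^{\le\omega}$. For a point $x$ of a space $X$, $\chi(x,X)$ denotes the least infinite cardinal $\kappa$ such that $x$ has a local base of size at most $\kappa$, and the character of $X$ is $\sup_{x\in X}\chi(x,X)$. A space is zero-dimensional if its clopen sets form a base. **Proposition 3.1.** Assume CH, i.e. $2^{\omega}=\omega_1$. Suppose there is a tree $T\subseteq 2^{<\omega_2}$ such that 1. each level of $T$ has cardinality at most $\omega_1$; 2. $T$ has no branch of size $\omega_2$; 3. $|T|>2^{\omega}$, or $T$ has strictly more than $2^{\omega}$ branches; 4. $T$ does not contain an isomorphic copy of the Cantor tree, i.e. no subset of $T$ with the induced order is isomorphic to $2^{\le\omega}$. Then there exist zero-dimensional $T_1$ Lindelöf spaces $X$, $X_0$,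 $X_1$ such that $X$ is a Hausdorff Lindelöf space of size $>2^{\omega}$, $X_0$ and $X_1$ are regular $T_1$ Lindelöf spaces of character $\le\omega_1$, and: 1. $X_0$ and $X_1$ have the same underlying set as $X$, and their topologies are finer than (contain) that of $X$. 2. For every $x\in X$, $\chi(x,X_0)=\chi(x,X_1)$. 3. For every $x\in X$ with $\chi(x,X_0)=\chi(x,X_1)=\omega_1$ there is a sequence $\langle O^x_\alpha:\alpha<\omega_1\rangle$ of clopen subsets of $X$ such that $O^x_\alpha\supseteq O^x_{\alpha+1}$ for all $\alpha<\omega_1$, $O^x_\alpha=\bigcap_{\beta<\alpha}O^x_\beta$ for every (nonzero) limit $\alpha<\omega_1$, and $\bigcap_{\alpha<\omega_1}O^x_\alpha=\{x\}$. 4. For every $x\in X$ with $\chi(x,X_0)=\chi(x,X_1)=\omega$ there are an open set $O_0$ of $X_0$ and an open set $O_1$ of $X_1$ with $O_0\cap O_1=\{x\}$. -/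

import Mathlib

open Set Cardinal TopologicalSpace
open scoped Topology

universe u

/-- A transfinite 0-1 sequence: a function from the ordinal `dom`, i.e. from the set of the
ordinals below `dom`, to `2 = {false, true}`. -/
structure BinSeq : Type (u + 1) where
  dom : Ordinal.{u}
  val : Set.Iio dom → Bool

namespace BinSeq

/-- `s ≤ t` iff `s ⊆ t` as functions (sets of ordered pairs), i.e. `t` extends `s`. -/
instance : PartialOrder BinSeq.{u} where
  le s t := ∃ h : s.dom ≤ t.dom, ∀ β : Set.Iio s.dom, s.val β = t.val ⟨β.1, β.2.trans_le h⟩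
  le_refl s := ⟨le_rfl, fun _ => rfl⟩
  le_trans s t r := by
    rintro ⟨h, hst⟩ ⟨k, htr⟩
    exact ⟨h.trans k, fun β => (hst β).trans (htr _)⟩
  le_antisymm s t := by
    rintro ⟨h, hst⟩ ⟨k, -⟩
    obtain ⟨a, f⟩ := s
    obtain ⟨b, g⟩ := t
    obtain rfl : a = b := le_antisymm h k
    obtain rfl : f = g := funext hst
    rfl

end BinSeq

/-- `2^{<α}`. -/
def binSeqLT (α : Ordinal.{u}) : Set BinSeq.{u} := {s | s.dom < α}

/-- `2^{≤α}`. -/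
def binSeqLE (α : Ordinal.{u}) : Set BinSeq.{u} := {s | s.dom ≤ α}

/-- `T` is a tree contained in `2^{<α}`: a downward closed subset of `2^{<α}`. -/
def IsTreeIn (α : Ordinal.{u}) (T : Set BinSeq.{u}) : Prop :=
  T ⊆ binSeqLT α ∧ ∀ s ∈ T, ∀ t ∈ binSeqLT α, t ≤ s → t ∈ T

/-- The level of height `β` of `T`. -/
def treeLevel (T : Set BinSeq.{u}) (β : Ordinal.{u}) : Set BinSeq.{u} := {t ∈ T | t.dom = β}

/-- The branches of `T`: its maximal chains. -/
def branches (T : Set BinSeq.{u}) : Set (Set T) := {B | IsMaxChain (· ≤ ·) B}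

/-- The Cantor tree `2^{≤ω}`. -/
def cantorTree : Set BinSeq.{u} := binSeqLE Ordinal.omega0

/-- `T` contains an isomorphic copy of the Cantor tree: some subset of `T`, with the order of `T`,
is isomorphic to it. -/
def ContainsCantorTree (T : Set BinSeq.{u}) : Prop :=
  ∃ S : Set BinSeq.{u}, S ⊆ T ∧ Nonempty (cantorTree.{u} ≃o S)

/-- `ℬ` is a local base at `x`, consisting of open sets. -/
def IsLocalBase {X : Type u} (τ : TopologicalSpace X) (x : X) (ℬ : Set (Set X)) : Prop :=
  (∀ U ∈ ℬ, IsOpen[τ] U ∧ x ∈ U) ∧ ∀ V : Set X, IsOpen[τ] V → x ∈ V → ∃ U ∈ ℬ, U ⊆ V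

/-- The character `χ(x, X)`: the least infinite cardinal `κ` such that `x` has a local base of size
at most `κ`; so it is `ℵ₀` at an isolated point. -/
noncomputable def pointCharacter {X : Type u} (τ : TopologicalSpace X) (x : X) : Cardinal.{u} :=
  sInf {κ | ℵ₀ ≤ κ ∧ ∃ ℬ : Set (Set X), IsLocalBase τ x ℬ ∧ #ℬ ≤ κ}

/-- The character `χ(X) = sup {χ(x, X) | x ∈ X}` of a space. -/
noncomputable def spaceCharacter {X : Type u} (τ : TopologicalSpace X) : Cardinal.{u} :=
  ⨆ x : X, pointCharacter τ x

/-- Zero-dimensional: the clopen sets form a base. -/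
def IsZeroDimensional {X : Type u} (τ : TopologicalSpace X) : Prop :=
  @IsTopologicalBasis X τ {U | @IsClopen X τ U}

/-- `τ` is a zero-dimensional `T₁` Lindelöf topology. -/
structure IsZeroDimT1Lindelof {X : Type u} (τ : TopologicalSpace X) : Prop where
  zeroDim : IsZeroDimensional τ
  t1 : @T1Space X τ
  lindelof : @LindelofSpace X τ

/-- `τ` is a regular `T₁` Lindelöf topology of character at most `ℵ₁`. -/
structure IsRegularT1LindelofCharLE {X : Type u} (τ : TopologicalSpace X) : Prop where
  regular : @RegularSpace X τ
  t1 : @T1Space X τ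
  lindelof : @LindelofSpace X τ
  character_le : spaceCharacter τ ≤ ℵ_ 1

/-- The sequence `O` of length `ω₁` (only the values at `α < ω₁` matter) consists of clopen sets,
is decreasing, continuous at limits, and shrinks to the point `x`. -/
structure IsShrinkingClopenSeq {X : Type u} (τ : TopologicalSpace X) (x : X)
    (O : Ordinal.{u} → Set X) : Prop where
  clopen : ∀ α < Ordinal.omega 1, @IsClopen X τ (O α)
  succ_subset : ∀ α < Ordinal.omega 1, O (Order.succ α) ⊆ O α
  limit_eq : ∀ α < Ordinal.omega 1, Order.IsSuccLimit α → O α = ⋂ β < α, O β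
  inter_eq : ⋂ α < Ordinal.omega 1, O α = {x}

/-- The hypotheses on three spaces `X`, `X₀`, `X₁` with a common underlying set, given by the
topologies `τ`, `τ₀`, `τ₁`, under which the points can be modified to get two regular `T₁` Lindelöf
spaces with points `G_δ` whose product has extent `|X|`. -/
structure ModificationHypotheses {X : Type u} (τ τ₀ τ₁ : TopologicalSpace X) : Prop where
  hausdorff : @T2Space X τ
  lindelof : @LindelofSpace X τ
  card_gt : 𝔠 < #X
  space₀ : IsRegularT1LindelofCharLE τ₀
  space₁ : IsRegularT1LindelofCharLE τ₁
  finer₀ : ∀ U : Set X, IsOpen[τ] U → IsOpen[τ₀] U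
  finer₁ : ∀ U : Set X, IsOpen[τ] U → IsOpen[τ₁] U
  character_eq : ∀ x : X, pointCharacter τ₀ x = pointCharacter τ₁ x
  character_aleph_one : ∀ x : X, pointCharacter τ₀ x = ℵ_ 1 → pointCharacter τ₁ x = ℵ_ 1 →
    ∃ O : Ordinal.{u} → Set X, IsShrinkingClopenSeq τ x O
  character_aleph_zero : ∀ x : X, pointCharacter τ₀ x = ℵ₀ → pointCharacter τ₁ x = ℵ₀ →
    ∃ O₀ O₁ : Set X, IsOpen[τ₀] O₀ ∧ IsOpen[τ₁] O₁ ∧ O₀ ∩ O₁ = {x}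

/-!
The points of `X` are the sequences all of whose proper initial segments lie in `T`: the elements of
`T` and the bounded paths through it. A basic neighbourhood of a path `x` of limit length consists
of the sequences that extend a given `r < x` properly and do not extend `x` properly; points may
also be declared isolated, and only countably cofinal ones are.

The only obstacle to the Lindelöf property is a copy of `2^{<ω}` in `T` all of whose paths have
isolated limits. Indeed, if a countably complete filter `f` has no cluster point, then
`{s | ∃ᶠ y in f, s ≤ y}` is not a chain, since its least upper bound would be an initial segment of
`f`-almost all points; applied to restrictions of `f`, this makes the set split everywhere, and it
is contained in `T`. Shrinking to a countable splitting subset whose supremum of lengths is minimal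
yields a copy of `2^{<ω}` with all paths of the same length.

As `T` contains no Cantor tree, each such copy has continuum many limits outside `T`: otherwise one
could interleave a path with each of continuum many others and find a subcopy all of whose limits
lie in `T`. There are at most continuum many copies of each length, so a transfinite recursion
yields a set `D` such that `D` and its complement both contain a limit outside `T` of every copy.
Isolating all countably cofinal points of `T` gives `X`; isolating those outside `D`, respectively
those outside `Dᶜ`, as well gives `X₀` and `X₁`.
-/

open Filter PiNat

universe v

/-! ### Binary sequences -/

namespace BinSeq

variable {r s t x : BinSeq.{u}} {β : Ordinal.{u}}

/-- The sequence of length `α` with entries `v β`, `β < α`. -/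
def ofFun (α : Ordinal.{u}) (v : Ordinal.{u} → Bool) : BinSeq.{u} := ⟨α, fun β => v β⟩

open Classical in
/-- The `β`-th entry of a sequence, with junk value `false` beyond its length. -/
noncomputable def entry (s : BinSeq.{u}) (β : Ordinal.{u}) : Bool :=
  if h : β < s.dom then s.val ⟨β, h⟩ else false

theorem entry_ofFun {α : Ordinal.{u}} {v : Ordinal.{u} → Bool} (h : β < α) :
    (ofFun α v).entry β = v β :=
  dif_pos h

theorem le_iff : s ≤ t ↔ s.dom ≤ t.dom ∧ ∀ β < s.dom, s.entry β = t.entry β := by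
  refine ⟨fun ⟨h, hst⟩ => ⟨h, fun β hβ => ?_⟩, fun ⟨h, hst⟩ => ⟨h, fun ⟨β, hβ⟩ => ?_⟩⟩
  · simpa only [entry, hβ, hβ.trans_le h, dif_pos] using hst ⟨β, hβ⟩
  · have hβ : β < s.dom := hβ
    simpa only [entry, hβ, hβ.trans_le h, dif_pos] using hst β hβ

instance : OrderBot BinSeq.{u} where
  bot := ofFun 0 fun _ => false
  bot_le _ := le_iff.2 ⟨zero_le, fun _ hβ => absurd hβ not_lt_zero⟩

theorem entry_eq_of_le (h : s ≤ t) (hβ : β < s.dom) : s.entry β = t.entry β :=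
  (le_iff.1 h).2 β hβ

theorem le_of_dom_le (hr : r ≤ t) (hs : s ≤ t) (hd : r.dom ≤ s.dom) : r ≤ s :=
  le_iff.2 ⟨hd, fun _ hβ =>
    (entry_eq_of_le hr hβ).trans (entry_eq_of_le hs (hβ.trans_le hd)).symm⟩

theorem eq_of_dom_eq (hr : r ≤ t) (hs : s ≤ t) (hd : r.dom = s.dom) : r = s :=
  (le_of_dom_le hr hs hd.le).antisymm (le_of_dom_le hs hr hd.ge)

theorem lt_of_dom_lt (hr : r ≤ t) (hs : s ≤ t) (hd : r.dom < s.dom) : r < s :=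
  (le_of_dom_le hr hs hd.le).lt_of_ne fun h => hd.ne (congrArg dom h)

theorem dom_strictMono : StrictMono dom := fun _ _ h =>
  h.le.1.lt_of_ne fun hd => h.ne (eq_of_dom_eq h.le le_rfl hd)

instance : WellFoundedLT BinSeq.{u} := dom_strictMono.wellFoundedLT

theorem le_total_of_le (hr : r ≤ t) (hs : s ≤ t) : r ≤ s ∨ s ≤ r :=
  (le_total r.dom s.dom).imp (le_of_dom_le hr hs) (le_of_dom_le hs hr)

theorem lt_of_not_le (hr : r ≤ t) (hs : s ≤ t) (h : ¬ r ≤ s) : s < r :=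
  ((le_total_of_le hr hs).resolve_left h).lt_of_not_ge h

theorem le_of_incompRel (h : IncompRel (· ≤ ·) r s) (hr : t ≤ r ∨ r ≤ t) (hs : t ≤ s ∨ s ≤ t) :
    t ≤ r := by
  refine hr.resolve_right fun hrt => ?_
  rcases hs with hts | hst
  · exact h.1 (hrt.trans hts)
  · exact (le_total_of_le hrt hst).elim h.1 h.2

theorem exists_lt_of_lt_isLUB {S : Set BinSeq.{u}} (hS : IsLUB S x) (hr : r < x) :
    ∃ s ∈ S, r < s := by
  by_contra! H
  refine hr.not_ge (hS.2 fun s hs => ?_)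
  by_contra hsr
  exact H s hs (lt_of_not_le (hS.1 hs) hr.le hsr)

theorem exists_isLUB {S : Set BinSeq.{u}} (hS : IsChain (· ≤ ·) S) (hb : BddAbove (dom '' S)) :
    ∃ x, IsLUB S x := by
  have hlong : ∀ β, β < sSup (dom '' S) → ∃ s ∈ S, β < s.dom := fun β hβ => by
    simpa only [exists_mem_image] using exists_lt_of_lt_csSup' hβ
  choose! g hgS hg using hlong
  have hagree : ∀ s ∈ S, ∀ t ∈ S, ∀ β < s.dom, β < t.dom → s.entry β = t.entry β :=
    fun s hs t ht β hβs hβt => (hS.total hs ht).elim (entry_eq_of_le · hβs)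
      fun h => (entry_eq_of_le h hβt).symm
  refine ⟨ofFun (sSup (dom '' S)) fun β => (g β).entry β, fun s hs => ?_, fun t ht => ?_⟩
  · have hs' : s.dom ≤ sSup (dom '' S) := le_csSup hb (mem_image_of_mem dom hs)
    refine le_iff.2 ⟨hs', fun β hβ => ?_⟩
    have hβ' := hβ.trans_le hs'
    rw [entry_ofFun hβ']
    exact hagree s hs _ (hgS β hβ') β hβ (hg β hβ')
  · refine le_iff.2 ⟨csSup_le' (forall_mem_image.2 fun s hs => (ht hs).1), fun β hβ => ?_⟩
    exact (entry_ofFun hβ).trans (entry_eq_of_le (ht (hgS β hβ)) (hg β hβ))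

/-- The initial segment of length `β`; for `β > s.dom` it is padded with `false`. -/
noncomputable def restrict (s : BinSeq.{u}) (β : Ordinal.{u}) : BinSeq.{u} := ofFun β s.entry

theorem restrict_le (h : β ≤ s.dom) : s.restrict β ≤ s :=
  le_iff.2 ⟨h, fun _ hγ => entry_ofFun hγ⟩

theorem restrict_lt (h : β < s.dom) : s.restrict β < s :=
  lt_of_dom_lt (restrict_le h.le) le_rfl h

/-- The extension of a sequence by one more entry. -/
noncomputable def snoc (s : BinSeq.{u}) (i : Bool) : BinSeq.{u} :=
  ofFun (Order.succ s.dom) fun β => open Classical in if β = s.dom then i else s.entry β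

theorem snoc_le_iff {i : Bool} : s.snoc i ≤ t ↔ s < t ∧ t.entry s.dom = i := by
  have hlast : (s.snoc i).entry s.dom = i := by
    rw [snoc, entry_ofFun (Order.lt_succ _), if_pos rfl]
  have hinit : ∀ β < s.dom, (s.snoc i).entry β = s.entry β := fun β hβ => by
    rw [snoc, entry_ofFun (hβ.trans (Order.lt_succ _)), if_neg hβ.ne]
  have hs : s ≤ s.snoc i := le_iff.2 ⟨Order.le_succ _, fun β hβ => (hinit β hβ).symm⟩
  constructor
  · intro h
    exact ⟨lt_of_dom_lt (hs.trans h) le_rfl ((Order.lt_succ s.dom).trans_le h.1),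
      hlast ▸ (entry_eq_of_le h (Order.lt_succ s.dom)).symm⟩
  · rintro ⟨h, rfl⟩
    refine le_iff.2 ⟨Order.succ_le_of_lt (dom_strictMono h), fun β hβ => ?_⟩
    rcases (Order.lt_succ_iff.1 hβ).eq_or_lt with rfl | hβ
    · exact hlast
    · exact (hinit β hβ).trans (entry_eq_of_le h.le hβ)

theorem lt_snoc (s : BinSeq.{u}) (i : Bool) : s < s.snoc i := (snoc_le_iff.1 le_rfl).1

theorem exists_snoc_le (h : s < t) : ∃ i, s.snoc i ≤ t := ⟨_, snoc_le_iff.2 ⟨h, rfl⟩⟩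

theorem lt_snoc_iff {i : Bool} : r < s.snoc i ↔ r ≤ s := by
  refine ⟨fun h => le_of_dom_le h.le (s.lt_snoc i).le ?_, fun h => h.trans_lt (s.lt_snoc i)⟩
  exact Order.lt_succ_iff.1 (dom_strictMono h)

theorem eq_bot_or_snoc_or_isSuccLimit (s : BinSeq.{u}) :
    s = ⊥ ∨ (∃ (r : BinSeq.{u}) (i : Bool), s = r.snoc i) ∨ Order.IsSuccLimit s.dom := by
  rcases Ordinal.zero_or_succ_or_isSuccLimit s.dom with h | ⟨β, h⟩ | h
  · exact .inl (eq_of_dom_eq le_rfl bot_le h)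
  · obtain ⟨i, hi⟩ := exists_snoc_le (restrict_lt (h ▸ Order.lt_succ β))
    exact .inr (.inl ⟨_, i, (eq_of_dom_eq hi le_rfl h).symm⟩)
  · exact .inr (.inr h)

section Limit

variable (hs : Order.IsSuccLimit s.dom)
include hs

theorem exists_lt_of_isSuccLimit : ∃ r, r < s :=
  ⟨_, restrict_lt (pos_iff_ne_zero.2 hs.ne_bot)⟩

theorem le_of_forall_lt_le (h : ∀ r < s, r ≤ t) : s ≤ t := by
  have hentry : ∀ β < s.dom, β < t.dom ∧ s.entry β = t.entry β := fun β hβ => by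
    have hr := restrict_lt (hs.succ_lt hβ)
    exact ⟨Order.succ_le_iff.1 (h _ hr).1, (entry_eq_of_le hr.le (Order.lt_succ β)).symm.trans
      (entry_eq_of_le (h _ hr) (Order.lt_succ β))⟩
  exact le_iff.2 ⟨le_of_forall_lt fun β hβ => (hentry β hβ).1, fun β hβ => (hentry β hβ).2⟩

theorem exists_lt_not_le (h : ¬ s ≤ t) : ∃ r < s, ¬ r ≤ t := by
  by_contra! H
  exact h (le_of_forall_lt_le hs H)

end Limit

theorem mk_Iio (x : BinSeq.{u}) : #(Iio x) = lift.{u + 1} x.dom.card := by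
  rw [← mk_Iio_ordinal]
  refine mk_congr (.ofBijective (fun r => ⟨r.1.dom, dom_strictMono r.2⟩) ⟨fun r s h => ?_, ?_⟩)
  · exact Subtype.ext (eq_of_dom_eq (le_of_lt r.2) (le_of_lt s.2) (congrArg Subtype.val h))
  · exact fun β => ⟨⟨_, restrict_lt β.2⟩, rfl⟩

/-- Countable cofinality of the length of `x`, expressed through its initial segments; it includes
the sequences of successor length and the empty one. -/
def CountablyCofinal (x : BinSeq.{u}) : Prop :=
  ∃ S : Set BinSeq.{u}, S.Countable ∧ S ⊆ Iio x ∧ ∀ r < x, ∃ s ∈ S, r ≤ s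

theorem isSuccLimit_of_not_countablyCofinal (h : ¬ x.CountablyCofinal) :
    Order.IsSuccLimit x.dom := by
  rcases x.eq_bot_or_snoc_or_isSuccLimit with rfl | ⟨s, i, rfl⟩ | hx
  · exact absurd ⟨∅, countable_empty, empty_subset _, fun r hr => absurd hr not_lt_bot⟩ h
  · exact absurd ⟨{s}, countable_singleton s, singleton_subset_iff.2 (s.lt_snoc i),
      fun r hr => ⟨s, rfl, lt_snoc_iff.1 hr⟩⟩ h
  · exact hx

theorem exists_forall_lt_of_not_countablyCofinal (h : ¬ x.CountablyCofinal)
    {S : Set BinSeq.{u}} (hS : S.Countable) (hSx : S ⊆ Iio x) : ∃ r < x, ∀ s ∈ S, s < r := by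
  by_contra! H
  refine h ⟨S, hS, hSx, fun r hr => ?_⟩
  obtain ⟨s, hs, hsr⟩ := H r hr
  refine ⟨s, hs, ?_⟩
  by_contra hrs
  exact hsr (lt_of_not_le hr.le (hSx hs).le hrs)

end BinSeq

open BinSeq

instance small_binSeqLT (κ : Ordinal.{u}) : Small.{u} (binSeqLT κ) := by
  let g : binSeqLT κ → Σ β : Iio κ, (Iio β.1 → Bool) := fun s => ⟨⟨s.1.dom, s.2⟩, s.1.val⟩
  refine small_of_injective (f := g) ?_
  rintro ⟨⟨a, f⟩, _⟩ ⟨⟨a', f'⟩, _⟩ h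
  obtain ⟨h₁, h₂⟩ := Sigma.mk.inj h
  obtain rfl : a = a' := congrArg Subtype.val h₁
  cases h₂
  rfl

/-! ### The path topologies -/

theorem regularSpace_of_isZeroDimensional {X : Type u} {τ : TopologicalSpace X}
    (h : IsZeroDimensional τ) : RegularSpace X := by
  refine .of_exists_mem_nhds_isClosed_subset fun x s hs => ?_
  obtain ⟨U, hU, hx, hUs⟩ := (IsTopologicalBasis.mem_nhds_iff h).1 hs
  exact ⟨U, IsOpen.mem_nhds hU.2 hx, hU.1, hUs⟩

theorem IsZeroDimensional.induced {X : Type u} {Y : Type v} {τ : TopologicalSpace Y}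
    (h : IsZeroDimensional τ) (f : X → Y) : IsZeroDimensional (τ.induced f) := by
  let _ := τ.induced f
  refine (IsTopologicalBasis.induced f h).of_isOpen_of_subset (fun _ hU => hU.isOpen) ?_
  rintro _ ⟨U, hU, rfl⟩
  exact hU.preimage continuous_induced_dom

section Character

variable {X : Type u} {τ : TopologicalSpace X} {x : X} {κ : Cardinal.{u}}

theorem pointCharacter_le_of_hasBasis {ι : Type v} {p : ι → Prop} {s : ι → Set X} (hκ : ℵ₀ ≤ κ)
    (h : (@nhds X τ x).HasBasis p s) (hopen : ∀ i, p i → IsOpen[τ] (s i))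
    (hcard : lift.{u} #{i | p i} ≤ lift.{v} κ) : pointCharacter τ x ≤ κ := by
  let _ := τ
  refine csInf_le' ⟨hκ, s '' {i | p i}, ⟨?_, fun V hV hx => ?_⟩, ?_⟩
  · rintro _ ⟨i, hi, rfl⟩
    exact ⟨hopen i hi, mem_of_mem_nhds (h.mem_of_mem hi)⟩
  · obtain ⟨i, hi, hiV⟩ := h.mem_iff.1 (hV.mem_nhds hx)
    exact ⟨s i, mem_image_of_mem s hi, hiV⟩
  · exact lift_le.1 (mk_image_le_lift.trans hcard)

theorem pointCharacter_spec (τ : TopologicalSpace X) (x : X) :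
    ℵ₀ ≤ pointCharacter τ x ∧
      ∃ ℬ : Set (Set X), IsLocalBase τ x ℬ ∧ #ℬ ≤ pointCharacter τ x :=
  csInf_mem (s := {κ | ℵ₀ ≤ κ ∧ ∃ ℬ : Set (Set X), IsLocalBase τ x ℬ ∧ #ℬ ≤ κ})
    ⟨max ℵ₀ #(Set X), le_max_left _ _, {U | IsOpen[τ] U ∧ x ∈ U},
      ⟨fun _ hU => hU, fun V hV hx => ⟨V, ⟨hV, hx⟩, Subset.rfl⟩⟩,
      (mk_subtype_le _).trans (le_max_right _ _)⟩

theorem pointCharacter_eq_aleph0_iff :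
    pointCharacter τ x = ℵ₀ ↔ (@nhds X τ x).IsCountablyGenerated := by
  let _ := τ
  constructor
  · intro h
    obtain ⟨-, ℬ, hℬ, hcard⟩ := pointCharacter_spec τ x
    rw [h, le_aleph0_iff_set_countable] at hcard
    have hbasis : (𝓝 x).HasBasis (· ∈ ℬ) id := by
      refine (nhds_basis_opens x).to_hasBasis (fun V hV => hℬ.2 V hV.2 hV.1) fun U hU => ?_
      exact ⟨U, (hℬ.1 U hU).symm, Subset.rfl⟩
    exact HasCountableBasis.isCountablyGenerated ⟨hbasis, hcard⟩
  · intro h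
    obtain ⟨U, hU, hbasis⟩ := (nhds_basis_opens x).exists_antitone_subbasis
    refine le_antisymm ?_ (pointCharacter_spec τ x).1
    exact pointCharacter_le_of_hasBasis le_rfl hbasis.toHasBasis (fun n _ => (hU n).2) (by simp)

end Character

/-- The topology on all sequences in which the sequences of limit length in `A` have the sets
`Ioi r \ Ioi x`, `r < x`, as a local base, and all other points are isolated. -/
@[reducible] def pathTopology (A : Set BinSeq.{u}) : TopologicalSpace BinSeq.{u} where
  IsOpen U := ∀ x ∈ U, x ∈ A → Order.IsSuccLimit x.dom → ∃ r < x, Ioi r \ Ioi x ⊆ U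
  isOpen_univ x _ _ hlim :=
    (exists_lt_of_isSuccLimit hlim).imp fun _ hr => ⟨hr, subset_univ _⟩
  isOpen_inter U V hU hV x hx hA hlim := by
    obtain ⟨r, hr, hrU⟩ := hU x hx.1 hA hlim
    obtain ⟨s, hs, hsV⟩ := hV x hx.2 hA hlim
    rcases le_total_of_le hr.le hs.le with h | h
    · exact ⟨s, hs, subset_inter ((sdiff_subset_sdiff_left (Ioi_subset_Ioi h)).trans hrU) hsV⟩
    · exact ⟨r, hr, subset_inter hrU ((sdiff_subset_sdiff_left (Ioi_subset_Ioi h)).trans hsV)⟩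
  isOpen_sUnion 𝒰 h𝒰 x hx hA hlim := by
    obtain ⟨U, hU, hxU⟩ := hx
    obtain ⟨r, hr, hrU⟩ := h𝒰 U hU x hxU hA hlim
    exact ⟨r, hr, hrU.trans (subset_sUnion_of_mem hU)⟩

section PathTopology

variable {A : Set BinSeq.{u}} {x : BinSeq.{u}}

theorem pathTopology_mono : Monotone pathTopology.{u} :=
  fun _ _ h _ hU x hx hA hlim => hU x hx (h hA) hlim

theorem isOpen_singleton_pathTopology (h : x ∈ A → ¬ Order.IsSuccLimit x.dom) :
    IsOpen[pathTopology A] {x} := by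
  rintro _ rfl hA hlim
  exact absurd hlim (h hA)

theorem isClopen_Ioi (A : Set BinSeq.{u}) (s : BinSeq.{u}) :
    @IsClopen _ (pathTopology A) (Ioi s) := by
  let _ := pathTopology A
  refine ⟨⟨fun x hx _ hlim => ?_⟩, fun x hx _ _ => ⟨s, hx, sdiff_subset⟩⟩
  by_cases h : x ≤ s
  · obtain ⟨r, hr⟩ := exists_lt_of_isSuccLimit hlim
    exact ⟨r, hr, fun y hy hsy => hy.2 (h.trans_lt hsy)⟩
  · obtain ⟨r, hr, hrs⟩ := exists_lt_not_le hlim h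
    exact ⟨r, hr, fun y hy hsy => hx ((lt_of_not_le hy.1.le hsy.le hrs).trans hr)⟩

theorem isClopen_Ioi_diff (A : Set BinSeq.{u}) (r s : BinSeq.{u}) :
    @IsClopen _ (pathTopology A) (Ioi r \ Ioi s) :=
  let _ := pathTopology A
  (isClopen_Ioi A r).diff (isClopen_Ioi A s)

theorem nhds_basis_pathTopology (hA : x ∈ A) (hlim : Order.IsSuccLimit x.dom) :
    (@nhds _ (pathTopology A) x).HasBasis (· < x) fun r => Ioi r \ Ioi x := by
  let _ := pathTopology A
  refine ⟨fun U => mem_nhds_iff.trans ⟨?_, ?_⟩⟩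
  · rintro ⟨V, hVU, hV, hxV⟩
    obtain ⟨r, hr, hrV⟩ := hV x hxV hA hlim
    exact ⟨r, hr, hrV.trans hVU⟩
  · rintro ⟨r, hr, hrU⟩
    exact ⟨_, hrU, (isClopen_Ioi_diff A r x).isOpen, hr, lt_irrefl x⟩

theorem t1Space_pathTopology (A : Set BinSeq.{u}) : @T1Space _ (pathTopology A) := by
  let _ := pathTopology A
  refine ⟨fun x => ⟨fun y hy _ hlim => ?_⟩⟩
  by_cases h : y ≤ x
  · obtain ⟨r, hr⟩ := exists_lt_of_isSuccLimit hlim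
    refine ⟨r, hr, ?_⟩
    rintro _ hz rfl
    exact hz.2 (h.lt_of_ne hy)
  · obtain ⟨r, hr, hrx⟩ := exists_lt_not_le hlim h
    refine ⟨r, hr, ?_⟩
    rintro _ hz rfl
    exact hrx hz.1.le

theorem isZeroDimensional_pathTopology (A : Set BinSeq.{u}) :
    IsZeroDimensional (pathTopology A) := by
  let _ := pathTopology A
  have := t1Space_pathTopology A
  refine isTopologicalBasis_of_isOpen_of_nhds (fun U hU => hU.isOpen) fun x U hx hU => ?_
  by_cases h : x ∈ A ∧ Order.IsSuccLimit x.dom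
  · obtain ⟨r, hr, hrU⟩ := hU x hx h.1 h.2
    exact ⟨_, isClopen_Ioi_diff A r x, ⟨hr, lt_irrefl x⟩, hrU⟩
  · exact ⟨{x}, ⟨isClosed_singleton, isOpen_singleton_pathTopology (not_and.1 h)⟩, rfl,
      singleton_subset_iff.2 hx⟩

theorem isCountablyGenerated_nhds_pathTopology (hx : x.CountablyCofinal) :
    (@nhds _ (pathTopology A) x).IsCountablyGenerated := by
  let _ := pathTopology A
  by_cases h : x ∈ A ∧ Order.IsSuccLimit x.dom
  · obtain ⟨S, hS, hSx, hcof⟩ := hx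
    have hbasis : (𝓝 x).HasBasis (· ∈ S) fun r => Ioi r \ Ioi x :=
      (nhds_basis_pathTopology h.1 h.2).to_hasBasis
        (fun r hr => (hcof r hr).imp fun s hs =>
          ⟨hs.1, sdiff_subset_sdiff_left (Ioi_subset_Ioi hs.2)⟩)
        fun s hs => ⟨s, hSx hs, Subset.rfl⟩
    exact HasCountableBasis.isCountablyGenerated ⟨hbasis, hS⟩
  · rw [(isOpen_singleton_iff_nhds_eq_pure x).1 (isOpen_singleton_pathTopology (not_and.1 h))]
    infer_instance

end PathTopology

/-- The sequences all of whose proper initial segments are in `T`. -/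
def pathClosure (T : Set BinSeq.{u}) : Set BinSeq.{u} := {s | ∀ r < s, r ∈ T}

/-- The topology in which, apart from the sequences of limit length that are not countably cofinal,
only the points of `D \ T` are kept from being isolated. The space `X` of the theorem is
`pathClosure T` with `D = univ`; `X₀` and `X₁` arise from complementary sets `D`. -/
@[reducible] def branchTopology (T D : Set BinSeq.{u}) : TopologicalSpace BinSeq.{u} :=
  pathTopology ({x | ¬ x.CountablyCofinal} ∪ D \ T)

theorem card_le_aleph_one_of_lt_omega_two {β : Ordinal.{u}} (h : β < Ordinal.omega 2) :
    β.card ≤ ℵ_ 1 := by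
  rwa [lt_omega_iff_card_lt, ← one_add_one_eq_two, ← succ_aleph,
    Order.lt_succ_iff] at h

theorem mk_Iio_le_aleph_one {x : BinSeq.{u}} (h : x.dom < Ordinal.omega 2) :
    #(Iio x) ≤ ℵ_ 1 := by
  rw [mk_Iio, lift_le_aleph_one]
  exact card_le_aleph_one_of_lt_omega_two h

section Subspace

variable {X : Type u} {A : Set BinSeq.{u}} {b : X → BinSeq.{u}} {x : X}

theorem pointCharacter_of_countablyCofinal (hx : (b x).CountablyCofinal) :
    pointCharacter ((pathTopology A).induced b) x = ℵ₀ := by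
  let _ := pathTopology A
  have := isCountablyGenerated_nhds_pathTopology (A := A) hx
  rw [pointCharacter_eq_aleph0_iff, nhds_induced]
  infer_instance

theorem nhds_basis_induced_of_not_countablyCofinal (hx : ¬ (b x).CountablyCofinal)
    (hA : b x ∈ A) : (@nhds _ ((pathTopology A).induced b) x).HasBasis (· < b x)
      fun r => b ⁻¹' (Ioi r \ Ioi (b x)) := by
  let _ := pathTopology A
  rw [nhds_induced]
  exact (nhds_basis_pathTopology hA (isSuccLimit_of_not_countablyCofinal hx)).comap b

theorem pointCharacter_ne_aleph0_of_not_countablyCofinal (hx : ¬ (b x).CountablyCofinal)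
    (hA : b x ∈ A) (hrange : Iio (b x) ⊆ range b) :
    pointCharacter ((pathTopology A).induced b) x ≠ ℵ₀ := by
  rw [Ne, pointCharacter_eq_aleph0_iff]
  intro _
  have hbasis := nhds_basis_induced_of_not_countablyCofinal hx hA
  obtain ⟨r, hr, hsub⟩ := hbasis.exists_antitone_subbasis
  obtain ⟨s, hs, hrs⟩ := exists_forall_lt_of_not_countablyCofinal hx (countable_range r)
    (range_subset_iff.2 hr)
  obtain ⟨y, rfl⟩ := hrange hs
  obtain ⟨n, hn⟩ := hsub.mem_iff.1 (hbasis.mem_of_mem hs)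
  have hy : y ∈ b ⁻¹' (Ioi (r n) \ Ioi (b x)) := ⟨hrs _ (mem_range_self n), hs.not_gt⟩
  exact lt_irrefl (b y) (hn hy).1

theorem pointCharacter_of_not_countablyCofinal (hx : ¬ (b x).CountablyCofinal)
    (hA : b x ∈ A) (hrange : Iio (b x) ⊆ range b) (hdom : (b x).dom < Ordinal.omega 2) :
    pointCharacter ((pathTopology A).induced b) x = ℵ_ 1 := by
  let _ := pathTopology A
  apply le_antisymm
  · refine pointCharacter_le_of_hasBasis (aleph0_le_aleph 1)
      (nhds_basis_induced_of_not_countablyCofinal hx hA)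
      (fun r _ => isOpen_induced (isClopen_Ioi_diff A r (b x)).isOpen) ?_
    simpa using! mk_Iio_le_aleph_one hdom
  · rw [← succ_aleph0, Order.succ_le_iff]
    exact (pointCharacter_spec _ x).1.lt_of_ne
      (pointCharacter_ne_aleph0_of_not_countablyCofinal hx hA hrange).symm

end Subspace

section Shrinking

variable {T D : Set BinSeq.{u}}

theorem isClopen_setOf_forall_lt {S : Set BinSeq.{u}} {d : BinSeq.{u}} (hS : S.Countable)
    (hd : IsLUB S d) (hdT : d ∈ T) :
    @IsClopen _ (branchTopology T D) {y | ∀ s ∈ S, s < y} := by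
  let _ := branchTopology T D
  by_cases hdS : d ∈ S
  · have : {y | ∀ s ∈ S, s < y} = Ioi d :=
      Subset.antisymm (fun y hy => hy d hdS) fun y hy s hs => (hd.1 hs).trans_lt hy
    exact this ▸ isClopen_Ioi _ d
  · have hSd : S ⊆ Iio d := fun s hs => (hd.1 hs).lt_of_ne fun h => hdS (h ▸ hs)
    have hcc : d.CountablyCofinal := ⟨S, hS, hSd, fun r hr =>
      (exists_lt_of_lt_isLUB hd hr).imp fun _ hs => ⟨hs.1, hs.2.le⟩⟩
    have := t1Space_pathTopology ({x | ¬ x.CountablyCofinal} ∪ D \ T)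
    have hsingleton : IsClopen {d} := ⟨isClosed_singleton, isOpen_singleton_pathTopology
      fun h => absurd h (not_or_intro (not_not_intro hcc) fun h => h.2 hdT)⟩
    have : {y | ∀ s ∈ S, s < y} = {d} ∪ Ioi d := by
      refine Subset.antisymm (fun y hy => ?_) ?_
      · exact (hd.2 fun s hs => (hy s hs).le).eq_or_lt'
      · rintro y (rfl | hy) s hs
        exacts [hSd hs, (hSd hs).trans hy]
    exact this ▸ hsingleton.union (isClopen_Ioi _ d)

theorem exists_enumeration_Iio {x : BinSeq.{u}} (hx : ¬ x.CountablyCofinal)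
    (hdom : x.dom < Ordinal.omega 2) :
    ∃ e : Ordinal.{u} → BinSeq.{u}, e '' Iio (Ordinal.omega 1) = Iio x := by
  obtain ⟨r, hr⟩ := exists_lt_of_isSuccLimit (isSuccLimit_of_not_countablyCofinal hx)
  have hcard : #(Iio x) ≤ #(Iio (Ordinal.omega.{u} 1)) := by
    rw [mk_Iio_ordinal, Ordinal.card_omega]
    simpa using mk_Iio_le_aleph_one hdom
  have : Nonempty (Iio x) := ⟨⟨r, hr⟩⟩
  obtain ⟨g, hg⟩ : ∃ g : Iio (Ordinal.omega.{u} 1) → Iio x, Function.Surjective g := by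
    obtain ⟨i⟩ := hcard
    exact ⟨_, Function.invFun_surjective i.injective⟩
  refine ⟨Function.extend Subtype.val (fun η => (g η).1) fun _ => ⊥, ?_⟩
  ext s
  constructor
  · rintro ⟨η, hη, rfl⟩
    rw [Subtype.val_injective.extend_apply _ _ ⟨η, hη⟩]
    exact (g _).2
  · intro hs
    obtain ⟨η, hη⟩ := hg ⟨s, hs⟩
    exact ⟨η, η.2, by rw [Subtype.val_injective.extend_apply, hη]⟩

theorem isClopen_setOf_forall_lt_of_not_countablyCofinal {S : Set BinSeq.{u}} {x : BinSeq.{u}}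
    (hS : S.Countable) (hx : ¬ x.CountablyCofinal) (hxT : x ∈ pathClosure T) (hSx : S ⊆ Iio x) :
    @IsClopen _ (branchTopology T D) {y | ∀ s ∈ S, s < y} := by
  obtain ⟨r, hr, hSr⟩ := exists_forall_lt_of_not_countablyCofinal hx hS hSx
  obtain ⟨d, hd⟩ := exists_isLUB (S := S)
    (fun s hs t ht _ => le_total_of_le (hSr s hs).le (hSr t ht).le)
    ⟨r.dom, forall_mem_image.2 fun s hs => (hSr s hs).le.1⟩
  exact isClopen_setOf_forall_lt hS hd (hxT d ((hd.2 fun s hs => (hSr s hs).le).trans_lt hr))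

variable {X : Type u} {b : X → BinSeq.{u}} {x : X}

theorem isShrinkingClopenSeq_induced (hb : Function.Injective b) (hxT : b x ∈ pathClosure T)
    (hx : ¬ (b x).CountablyCofinal) {e : Ordinal.{u} → BinSeq.{u}}
    (he : e '' Iio (Ordinal.omega 1) = Iio (b x)) :
    IsShrinkingClopenSeq ((branchTopology T D).induced b) x
      fun ξ => {y | (∀ η < ξ, e η < b y) ∧ ¬ b x < b y} where
  clopen ξ hξ := by
    let _ := branchTopology T D
    let _ := (branchTopology T D).induced b
    have hcount : (e '' Iio ξ).Countable := by
      apply Countable.image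
      rw [lt_omega_iff_card_lt, ← succ_aleph0, Order.lt_succ_iff] at hξ
      rwa [← le_aleph0_iff_set_countable, mk_Iio_ordinal, lift_le_aleph0]
    have hclopen := isClopen_setOf_forall_lt_of_not_countablyCofinal (D := D) hcount hx hxT
      ((image_mono (Iio_subset_Iio hξ.le)).trans he.subset)
    simp only [forall_mem_image] at hclopen
    exact (hclopen.diff (isClopen_Ioi _ (b x))).preimage continuous_induced_dom
  succ_subset ξ _ y hy := ⟨fun η hη => hy.1 η (hη.trans (Order.lt_succ ξ)), hy.2⟩
  limit_eq ξ _ hlim := by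
    ext y
    simp only [mem_ofPred_eq, mem_iInter]
    exact ⟨fun h β hβ => ⟨fun η hη => h.1 η (hη.trans hβ), h.2⟩,
      fun h => ⟨fun η hη => (h _ (hlim.succ_lt hη)).1 η (Order.lt_succ η),
        (h 0 (pos_iff_ne_zero.2 hlim.ne_bot)).2⟩⟩
  inter_eq := by
    ext y
    simp only [mem_ofPred_eq, mem_iInter, mem_singleton_iff]
    constructor
    · intro h
      have hle : b x ≤ b y := by
        refine le_of_forall_lt_le (isSuccLimit_of_not_countablyCofinal hx) fun r hr => ?_
        obtain ⟨η, hη, rfl⟩ := he.superset hr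
        exact ((h _ ((isSuccLimit_omega 1).succ_lt hη)).1 η (Order.lt_succ η)).le
      exact (hb (hle.eq_of_not_lt (h 0 (Ordinal.omega_pos 1)).2)).symm
    · rintro rfl ξ hξ
      exact ⟨fun η hη => he.subset (mem_image_of_mem e (hη.trans hξ)), lt_irrefl _⟩

end Shrinking

/-! ### Binary systems and the Cantor tree -/

/-- A copy of the full binary tree `2^{<ω}` in `T`, all of whose paths have unions of length `δ`.
As in `PiNat.res`, a finite 0-1 sequence is the list of its entries with the last one first. -/
structure IsBinarySystem (T : Set BinSeq.{u}) (δ : Ordinal.{u}) (C : List Bool → BinSeq.{u}) :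
    Prop where
  mem : ∀ σ, C σ ∈ T
  le_cons : ∀ i σ, C σ ≤ C (i :: σ)
  incompRel : ∀ σ, IncompRel (· ≤ ·) (C (false :: σ)) (C (true :: σ))
  dom_lt : ∀ σ, (C σ).dom < δ
  cofinal : ∀ f, ∀ β < δ, ∃ n, β ≤ (C (res f n)).dom

namespace IsBinarySystem

variable {T : Set BinSeq.{u}} {δ : Ordinal.{u}} {C : List Bool → BinSeq.{u}}
  (hC : IsBinarySystem T δ C) {f g : ℕ → Bool}
include hC

theorem mono {T' : Set BinSeq.{u}} (h : T ⊆ T') : IsBinarySystem T' δ C :=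
  { hC with mem := fun σ => h (hC.mem σ) }

theorem eq_of_cons_le {i j : Bool} {σ : List Bool} {x : BinSeq.{u}} (hi : C (i :: σ) ≤ x)
    (hj : C (j :: σ) ≤ x) : i = j := by
  have key : C (false :: σ) ≤ x → ¬ C (true :: σ) ≤ x := fun h₀ h₁ =>
    (le_total_of_le h₀ h₁).elim (hC.incompRel σ).1 (hC.incompRel σ).2
  cases i <;> cases j
  exacts [rfl, absurd hj (key hi), absurd hi (key hj), rfl]

theorem lt_cons (i : Bool) (σ : List Bool) : C σ < C (i :: σ) :=
  (hC.le_cons i σ).lt_of_ne fun h =>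
    (Bool.eq_not_self i).1 (hC.eq_of_cons_le (h.ge.trans (hC.le_cons (!i) σ)) le_rfl)

theorem strictMono (f : ℕ → Bool) : StrictMono fun n => C (res f n) :=
  strictMono_nat_of_lt_succ fun _ => hC.lt_cons _ _

theorem res_eq_of_le {n : ℕ} {x : BinSeq.{u}} (hf : C (res f n) ≤ x) (hg : C (res g n) ≤ x) :
    res f n = res g n := by
  induction n with
  | zero => rfl
  | succ n ih =>
    have hres := ih (((hC.strictMono f).monotone n.le_succ).trans hf)
      (((hC.strictMono g).monotone n.le_succ).trans hg)
    rw [res_succ] at hf hg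
    rw [res_succ, res_succ, hres, hC.eq_of_cons_le hf (hres ▸ hg)]

theorem exists_limit (f : ℕ → Bool) : ∃ p, IsLUB (range fun n => C (res f n)) p :=
  exists_isLUB (hC.strictMono f).monotone.isChain_range
    ⟨δ, forall_mem_image.2 (forall_mem_range.2 fun _ => (hC.dom_lt _).le)⟩

/-- The union of the path of `C` given by `f`. -/
noncomputable def limit (f : ℕ → Bool) : BinSeq.{u} := (hC.exists_limit f).choose

theorem isLUB_limit (f : ℕ → Bool) : IsLUB (range fun n => C (res f n)) (hC.limit f) :=
  (hC.exists_limit f).choose_spec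

theorem exists_lt_of_lt_limit {r : BinSeq.{u}} (h : r < hC.limit f) : ∃ n, r < C (res f n) := by
  simpa only [exists_range_iff] using exists_lt_of_lt_isLUB (hC.isLUB_limit f) h

theorem lt_limit (f : ℕ → Bool) (n : ℕ) : C (res f n) < hC.limit f :=
  (hC.strictMono f n.lt_succ_self).trans_le ((hC.isLUB_limit f).1 (mem_range_self (n + 1)))

theorem dom_limit (f : ℕ → Bool) : (hC.limit f).dom = δ := by
  refine le_antisymm (le_of_not_gt fun h => ?_) (le_of_not_gt fun h => ?_)
  · obtain ⟨n, hn⟩ := hC.exists_lt_of_lt_limit (restrict_lt h)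
    exact (dom_strictMono hn).not_gt (hC.dom_lt _)
  · obtain ⟨n, hn⟩ := hC.cofinal f _ h
    exact (dom_strictMono (hC.lt_limit f n)).not_ge hn

theorem isSuccLimit_dom_limit (f : ℕ → Bool) : Order.IsSuccLimit (hC.limit f).dom := by
  refine Ordinal.isSuccLimit_iff.2
    ⟨(pos_of_gt (dom_strictMono (hC.lt_limit f 0))).ne', fun β hβ => ?_⟩
  obtain ⟨n, hn⟩ := hC.exists_lt_of_lt_limit (restrict_lt hβ.lt)
  exact hβ.2 (dom_strictMono hn) (dom_strictMono (hC.lt_limit f n))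

theorem limit_mem_pathClosure (hT : IsLowerSet T) (f : ℕ → Bool) :
    hC.limit f ∈ pathClosure T := fun _ hr =>
  have ⟨_, hn⟩ := hC.exists_lt_of_lt_limit hr
  hT hn.le (hC.mem _)

theorem limit_injective : Function.Injective hC.limit := fun f g h =>
  res_injective (funext fun n =>
    hC.res_eq_of_le (hC.lt_limit f n).le (h ▸ (hC.lt_limit g n).le))

section CantorTree

variable {s t : BinSeq.{u}}

theorem exists_embed (s : BinSeq.{u}) :
    ∃ p, IsLUB ((fun n => C (res (s.entry ∘ Nat.cast) n)) '' {n : ℕ | n ≤ s.dom}) p :=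
  exists_isLUB ((hC.strictMono _).monotone.isChain_range.mono (image_subset_range _ _))
    ⟨δ, forall_mem_image.2 (forall_mem_image.2 fun _ _ => (hC.dom_lt _).le)⟩

/-- The copy in `C` of a node `s` of the Cantor tree: the union of the path that follows the
entries of `s` with finite index. -/
noncomputable def embed (s : BinSeq.{u}) : BinSeq.{u} := (hC.exists_embed s).choose

theorem isLUB_embed (s : BinSeq.{u}) :
    IsLUB ((fun n => C (res (s.entry ∘ Nat.cast) n)) '' {n : ℕ | n ≤ s.dom}) (hC.embed s) :=
  (hC.exists_embed s).choose_spec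

theorem res_le_embed {n : ℕ} (hn : n ≤ s.dom) : C (res (s.entry ∘ Nat.cast) n) ≤ hC.embed s :=
  (hC.isLUB_embed s).1 (mem_image_of_mem _ hn)

theorem embed_eq_of_dom_eq {n : ℕ} (hn : s.dom = n) :
    hC.embed s = C (res (s.entry ∘ Nat.cast) n) := by
  refine (hC.isLUB_embed s).unique (IsGreatest.isLUB ⟨mem_image_of_mem _ hn.ge, ?_⟩)
  refine forall_mem_image.2 fun m hm => (hC.strictMono _).monotone ?_
  exact (Nat.cast_le (α := Ordinal.{u})).1 (hm.trans_eq hn)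

theorem embed_eq_limit (hs : Ordinal.omega0 ≤ s.dom) :
    hC.embed s = hC.limit (s.entry ∘ Nat.cast) := by
  have hall : {n : ℕ | n ≤ s.dom} = Set.univ :=
    eq_univ_of_forall fun n => (Ordinal.natCast_lt_omega0 n).le.trans hs
  have h := hC.isLUB_embed s
  rw [hall, image_univ] at h
  exact h.unique (hC.isLUB_limit _)

theorem embed_mem (h : ∀ f, hC.limit f ∈ T) (s : BinSeq.{u}) : hC.embed s ∈ T := by
  rcases lt_or_ge s.dom Ordinal.omega0 with hs | hs
  · obtain ⟨n, hn⟩ := Ordinal.lt_omega0.1 hs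
    exact hC.embed_eq_of_dom_eq hn ▸ hC.mem _
  · exact hC.embed_eq_limit hs ▸ h _

theorem embed_lt_embed (ht : t ∈ cantorTree) (h : s < t) : hC.embed s < hC.embed t := by
  obtain ⟨n, hn⟩ := Ordinal.lt_omega0.1 ((dom_strictMono h).trans_le ht)
  have hres : res (s.entry ∘ Nat.cast) n = res (t.entry ∘ Nat.cast) n :=
    res_eq_res.2 fun m hm => entry_eq_of_le h.le (hn ▸ Nat.cast_lt.2 hm)
  have hsucc : (n + 1 : ℕ) ≤ t.dom := by
    rw [Nat.cast_succ, ← hn]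
    exact Order.add_one_le_of_lt (dom_strictMono h)
  rw [hC.embed_eq_of_dom_eq hn, hres]
  exact (hC.strictMono _ n.lt_succ_self).trans_le (hC.res_le_embed hsucc)

theorem le_of_embed_le (hs : s ∈ cantorTree) (h : hC.embed s ≤ hC.embed t) : s ≤ t := by
  have hagree : ∀ β < s.dom, β < t.dom → s.entry β = t.entry β := fun β hβs hβt => by
    obtain ⟨n, rfl⟩ := Ordinal.lt_omega0.1 (hβs.trans_le hs)
    have hres := hC.res_eq_of_le (n := n + 1)
      ((hC.res_le_embed (by simpa using Order.add_one_le_of_lt hβs)).trans h)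
      (hC.res_le_embed (by simpa using Order.add_one_le_of_lt hβt))
    exact res_eq_res.1 hres n.lt_succ_self
  rcases le_or_gt s.dom t.dom with hd | hd
  · exact le_iff.2 ⟨hd, fun β hβ => hagree β hβ (hβ.trans_le hd)⟩
  · have hts : t ≤ s := le_iff.2 ⟨hd.le, fun β hβ => (hagree β (hβ.trans hd) hβ).symm⟩
    exact absurd h (hC.embed_lt_embed hs (lt_of_dom_lt hts le_rfl hd)).not_ge

theorem containsCantorTree (h : ∀ f, hC.limit f ∈ T) : ContainsCantorTree T := by
  let φ : cantorTree.{u} ↪o BinSeq.{u} := .ofMapLEIff (fun s => hC.embed s) fun s t =>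
    ⟨hC.le_of_embed_le s.2, fun hst => hst.eq_or_lt.elim (fun h => h ▸ le_rfl)
      fun h => (hC.embed_lt_embed t.2 h).le⟩
  exact ⟨range φ, range_subset_iff.2 fun s => hC.embed_mem h s, ⟨φ.orderIso⟩⟩

end CantorTree

end IsBinarySystem

/-- The finite sequence `g 0, i₀, g 1, i₁, …` with the entries `i₀, i₁, …` of the second argument at
the odd places; lists have their last entry first. -/
def interleaveList (g : ℕ → Bool) : List Bool → List Bool
  | [] => []
  | i :: σ => i :: g σ.length :: interleaveList g σ

/-- The sequence `g 0, f 0, g 1, f 1, …`; fixing `g` cuts a subsystem out of a binary system, and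
different `g` give disjoint subsystems of paths. -/
def interleaveSeq (g f : ℕ → Bool) (n : ℕ) : Bool :=
  if Even n then g (n / 2) else f (n / 2)

theorem interleaveSeq_two_mul (g f : ℕ → Bool) (n : ℕ) : interleaveSeq g f (2 * n) = g n := by
  simp [interleaveSeq]

theorem interleaveSeq_two_mul_add_one (g f : ℕ → Bool) (n : ℕ) :
    interleaveSeq g f (2 * n + 1) = f n := by
  rw [interleaveSeq, if_neg (Nat.not_even_two_mul_add_one n), Nat.mul_add_div two_pos]
  rfl

theorem res_interleaveSeq (g f : ℕ → Bool) (n : ℕ) :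
    res (interleaveSeq g f) (2 * n) = interleaveList g (res f n) := by
  induction n with
  | zero => rfl
  | succ n ih =>
    rw [Nat.mul_succ, res_succ, res_succ, res_succ, interleaveList, ih, res_length,
      interleaveSeq_two_mul, interleaveSeq_two_mul_add_one]

namespace IsBinarySystem

variable {T : Set BinSeq.{u}} {δ : Ordinal.{u}} {C : List Bool → BinSeq.{u}}
  (hC : IsBinarySystem T δ C)
include hC

theorem interleave (g : ℕ → Bool) : IsBinarySystem T δ (C ∘ interleaveList g) where
  mem _ := hC.mem _
  le_cons _ _ := (hC.le_cons _ _).trans (hC.le_cons _ _)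
  incompRel _ := hC.incompRel _
  dom_lt _ := hC.dom_lt _
  cofinal f β hβ := by
    obtain ⟨n, hn⟩ := hC.cofinal (interleaveSeq g f) β hβ
    refine ⟨n, hn.trans ?_⟩
    rw [Function.comp_apply, ← res_interleaveSeq]
    exact ((hC.strictMono _).monotone (Nat.le_mul_of_pos_left n two_pos)).1

theorem limit_interleave (g f : ℕ → Bool) :
    (hC.interleave g).limit f = hC.limit (interleaveSeq g f) := by
  refine eq_of_dom_eq (((hC.interleave g).isLUB_limit f).2 ?_) le_rfl
    (((hC.interleave g).dom_limit f).trans (hC.dom_limit _).symm)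
  rintro _ ⟨n, rfl⟩
  simp only [Function.comp_apply, ← res_interleaveSeq]
  exact (hC.lt_limit _ _).le

theorem continuum_le_mk (hT : ¬ ContainsCantorTree T) : 𝔠 ≤ #↥(range hC.limit \ T) := by
  have hex : ∀ g, ∃ f, hC.limit (interleaveSeq g f) ∉ T := fun g => by
    by_contra! H
    exact hT ((hC.interleave g).containsCantorTree fun f => hC.limit_interleave g f ▸ H f)
  choose F hF using hex
  let φ : (ℕ → Bool) → ↥(range hC.limit \ T) := fun g =>
    ⟨hC.limit (interleaveSeq g (F g)), mem_range_self _, hF g⟩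
  have hφ : Function.Injective φ := fun g g' h => by
    have h' := hC.limit_injective (Subtype.mk_eq_mk.1 h)
    funext n
    rw [← interleaveSeq_two_mul g (F g) n, h', interleaveSeq_two_mul]
  simpa using lift_mk_le_lift_mk_of_injective hφ

end IsBinarySystem

/-! ### Extracting and splitting binary systems -/

/-- Every element of `S` has two incomparable extensions in `S`. -/
def IsSplitting (S : Set BinSeq.{u}) : Prop :=
  ∀ t ∈ S, ∃ p : Bool → BinSeq.{u}, (∀ i, p i ∈ S ∧ t ≤ p i) ∧ IncompRel (· ≤ ·) (p false) (p true)

namespace IsSplitting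

variable {S : Set BinSeq.{u}}

theorem exists_countable_subset (hS : IsSplitting S) (hne : S.Nonempty) :
    ∃ R ⊆ S, R.Countable ∧ R.Nonempty ∧ IsSplitting R := by
  obtain ⟨t, ht⟩ := hne
  choose! p hp hinc using hS
  let g : List Bool → BinSeq.{u} := List.foldr (fun i t => p t i) t
  have hg : ∀ σ, g σ ∈ S := fun σ => by
    induction σ with
    | nil => exact ht
    | cons i σ ih => exact (hp _ ih i).1
  refine ⟨range g, range_subset_iff.2 hg, countable_range g, range_nonempty g, ?_⟩
  rintro _ ⟨σ, rfl⟩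
  exact ⟨p (g σ), fun i => ⟨⟨i :: σ, rfl⟩, (hp _ (hg σ) i).2⟩, hinc _ (hg σ)⟩

theorem inter_Ici (hS : IsSplitting S) (s : BinSeq.{u}) : IsSplitting (S ∩ Ici s) := by
  rintro t ⟨ht, hst⟩
  obtain ⟨p, hp, hinc⟩ := hS t ht
  exact ⟨p, fun i => ⟨⟨(hp i).1, hst.trans (hp i).2⟩, (hp i).2⟩, hinc⟩

theorem exists_cofinal_subset (hS : IsSplitting S) (hne : S.Nonempty) :
    ∃ R ⊆ S, R.Countable ∧ R.Nonempty ∧ IsSplitting R ∧ ∃ δ, (∀ s ∈ R, s.dom < δ) ∧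
      ∀ s ∈ R, ∀ β < δ, ∃ t ∈ R, s ≤ t ∧ β ≤ t.dom := by
  let Q : Set Ordinal.{u} := {δ | ∃ R ⊆ S, R.Countable ∧ R.Nonempty ∧ IsSplitting R ∧
    ∀ s ∈ R, s.dom < δ}
  have hQ : Q.Nonempty := by
    obtain ⟨R, hRS, hR, hRne, hRsplit⟩ := hS.exists_countable_subset hne
    have : Countable R := hR
    refine ⟨⨆ s : R, Order.succ s.1.dom, R, hRS, hR, hRne, hRsplit, fun s hs => ?_⟩
    exact Order.succ_le_iff.1 (Ordinal.le_iSup (fun s : R => Order.succ s.1.dom) ⟨s, hs⟩)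
  obtain ⟨R, hRS, hR, hRne, hRsplit, hdom⟩ := csInf_mem hQ
  refine ⟨R, hRS, hR, hRne, hRsplit, sInf Q, hdom, fun s hs β hβ => ?_⟩
  by_contra! H
  exact notMem_of_lt_csInf' hβ ⟨R ∩ Ici s, inter_subset_left.trans hRS, hR.mono inter_subset_left,
    ⟨s, hs, self_mem_Ici⟩, hRsplit.inter_Ici s, fun t ht => H t ht.1 ht.2⟩

theorem exists_isBinarySystem (hS : IsSplitting S) (hne : S.Nonempty) :
    ∃ δ C, IsBinarySystem S δ C := by
  obtain ⟨R, hRS, hR, hRne, hRsplit, δ, hdom, hcof⟩ := hS.exists_cofinal_subset hne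
  obtain ⟨e, rfl⟩ := hR.exists_eq_range hRne
  have hstep : ∀ (s : range e) (n : ℕ), ∃ p : Bool → range e,
      (∀ i, s.1 ≤ (p i).1 ∧ (e n).dom ≤ (p i).1.dom) ∧
        IncompRel (· ≤ ·) (p false).1 (p true).1 := fun s n => by
    obtain ⟨t, ht, hst, hn⟩ := hcof s s.2 _ (hdom (e n) (mem_range_self n))
    obtain ⟨p, hp, hinc⟩ := hRsplit t ht
    exact ⟨fun i => ⟨p i, (hp i).1⟩, fun i => ⟨hst.trans (hp i).2, hn.trans (hp i).2.1⟩, hinc⟩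
  choose p hp hinc using hstep
  let C : List Bool → range e := List.rec ⟨e 0, mem_range_self 0⟩ fun i σ s => p s σ.length i
  refine ⟨δ, fun σ => (C σ).1, fun σ => hRS (C σ).2, fun i σ => (hp _ _ i).1, fun σ => hinc _ _,
    fun σ => hdom _ (C σ).2, fun f β hβ => ?_⟩
  obtain ⟨_, ⟨n, rfl⟩, -, hn⟩ := hcof (e 0) (mem_range_self 0) β hβ
  refine ⟨n + 1, hn.trans ?_⟩
  have hcons : C (f n :: res f n) = p (C (res f n)) n (f n) := by
    simp only [C, res_length]
  simp only [res_succ, hcons]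
  exact (hp _ n _).2

end IsSplitting

theorem exists_injective_forall_mem {ι α : Type u} {κ : Cardinal.{u}} (hι : #ι ≤ κ)
    {Q : ι → Set α} (hQ : ∀ i, κ ≤ #(Q i)) :
    ∃ F : ι → α, Function.Injective F ∧ ∀ i, F i ∈ Q i := by
  obtain ⟨_, _, hord⟩ := exists_ord_eq_type_lt ι
  have hex : ∀ (i : ι) (g : ∀ j < i, α), ∃ x ∈ Q i, ∀ j hj, g j hj ≠ x := fun i g => by
    by_contra! H
    have hsub : Q i ⊆ range fun j : Iio i => g j j.2 := fun x hx => by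
      obtain ⟨j, hj, hx⟩ := H x hx
      exact ⟨⟨j, hj⟩, hx⟩
    exact ((mk_le_mk_of_subset hsub).trans mk_range_le).not_gt
      ((mk_Iio_lt i hord).trans_le (hι.trans (hQ i)))
  choose next hnext hne using hex
  let F : ι → α := wellFounded_lt.fix next
  have hF : ∀ i, F i = next i fun j _ => F j := wellFounded_lt.fix_eq next
  exact ⟨F, .of_lt_imp_ne fun i j hij => hF j ▸ hne j (fun k _ => F k) i hij,
    fun i => hF i ▸ hnext i _⟩

theorem exists_set_forall_inter_nonempty {ι α : Type u} {κ : Cardinal.{u}} (hκ : ℵ₀ ≤ κ)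
    (hι : #ι ≤ κ) {Q : ι → Set α} (hQ : ∀ i, κ ≤ #(Q i)) :
    ∃ E : Set α, ∀ i, (Q i ∩ E).Nonempty ∧ (Q i ∩ Eᶜ).Nonempty := by
  have hcard : #(ι × Bool) ≤ κ := by
    simpa using mul_le_of_le hκ hι ((natCast_lt_aleph0 (n := 2)).le.trans hκ)
  obtain ⟨F, hF, hFQ⟩ := exists_injective_forall_mem hcard fun i => hQ i.1
  refine ⟨range fun i => F (i, true), fun i => ⟨⟨F (i, true), hFQ (i, _), mem_range_self i⟩,
    ⟨F (i, false), hFQ (i, _), ?_⟩⟩⟩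
  rintro ⟨j, hj⟩
  exact absurd (hF hj) (by simp)

/-- `D` contains a limit outside `T` of every binary system in `T`. -/
def MeetsBinarySystems (T D : Set BinSeq.{u}) : Prop :=
  ∀ δ C (hC : IsBinarySystem T δ C), ∃ f, hC.limit f ∈ D \ T

theorem MeetsBinarySystems.mono {T D D' : Set BinSeq.{u}} (hD : MeetsBinarySystems T D)
    (h : D ⊆ D') : MeetsBinarySystems T D' := fun δ C hC =>
  (hD δ C hC).imp fun _ hf => ⟨h hf.1, hf.2⟩

section Counting

variable {T : Set BinSeq.{u}}

theorem mk_setOf_dom_lt_le (hlevel : ∀ β : Ordinal.{u}, #(treeLevel T β) ≤ 𝔠) {δ : Ordinal.{u}}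
    (hδ : δ.card ≤ 𝔠) : #{t // t ∈ T ∧ t.dom < δ} ≤ 𝔠 := by
  have hsub : {t | t ∈ T ∧ t.dom < δ} ⊆ ⋃ β : Iio δ, treeLevel T β :=
    fun t ht => mem_iUnion.2 ⟨⟨t.dom, ht.2⟩, ht.1, rfl⟩
  refine (mk_le_mk_of_subset hsub).trans ((mk_iUnion_le _).trans ?_)
  refine mul_le_of_le aleph0_le_continuum ?_ (ciSup_le' fun β => hlevel _)
  rwa [mk_Iio_ordinal, lift_le_continuum]

theorem mk_isBinarySystem_le (hlevel : ∀ β : Ordinal.{u}, #(treeLevel T β) ≤ 𝔠) {δ : Ordinal.{u}}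
    (hδ : δ.card ≤ 𝔠) : #{C // IsBinarySystem T δ C} ≤ 𝔠 := by
  let φ : {C // IsBinarySystem T δ C} → List Bool → {t // t ∈ T ∧ t.dom < δ} :=
    fun C σ => ⟨C.1 σ, C.2.mem σ, C.2.dom_lt σ⟩
  have hφ : Function.Injective φ := fun C C' h =>
    Subtype.ext (funext fun σ => congrArg Subtype.val (congrFun h σ))
  calc #{C // IsBinarySystem T δ C}
      ≤ #{t // t ∈ T ∧ t.dom < δ} ^ ℵ₀ := by simpa using mk_le_of_injective hφ
    _ ≤ 𝔠 ^ ℵ₀ := power_le_power_right (mk_setOf_dom_lt_le hlevel hδ)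
    _ = 𝔠 := continuum_power_aleph0

theorem exists_forall_limit_mem (hlevel : ∀ β : Ordinal.{u}, #(treeLevel T β) ≤ 𝔠)
    (hcantor : ¬ ContainsCantorTree T) {δ : Ordinal.{u}} (hδ : δ.card ≤ 𝔠) :
    ∃ G : Set BinSeq.{u}, ∀ C (hC : IsBinarySystem T δ C),
      (∃ f, hC.limit f ∈ G \ T) ∧ ∃ f, hC.limit f ∈ Gᶜ \ T := by
  obtain ⟨G, hG⟩ := exists_set_forall_inter_nonempty aleph0_le_continuum
    (mk_isBinarySystem_le hlevel hδ) fun C => C.2.continuum_le_mk hcantor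
  refine ⟨G, fun C hC => ?_⟩
  obtain ⟨⟨_, ⟨⟨f, rfl⟩, hfT⟩, hfG⟩, ⟨_, ⟨⟨g, rfl⟩, hgT⟩, hgG⟩⟩ := hG ⟨C, hC⟩
  exact ⟨⟨f, hfG, hfT⟩, ⟨g, hgG, hgT⟩⟩

theorem exists_meetsBinarySystems_compl (hlevel : ∀ β : Ordinal.{u}, #(treeLevel T β) ≤ 𝔠)
    (hcantor : ¬ ContainsCantorTree T) (hδ : ∀ δ C, IsBinarySystem T δ C → δ.card ≤ 𝔠) :
    ∃ D, MeetsBinarySystems T D ∧ MeetsBinarySystems T Dᶜ := by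
  choose! G hG using fun δ => exists_forall_limit_mem hlevel hcantor (δ := δ)
  refine ⟨{x | x ∈ G x.dom}, fun δ C hC => ?_, fun δ C hC => ?_⟩
  · obtain ⟨f, hf⟩ := (hG δ (hδ δ C hC) C hC).1
    exact ⟨f, by simpa [hC.dom_limit] using hf⟩
  · obtain ⟨f, hf⟩ := (hG δ (hδ δ C hC) C hC).2
    exact ⟨f, by simpa [hC.dom_limit] using hf⟩

end Counting

/-! ### The Lindelöf property -/

theorem eventually_ne_of_not_clusterPt {X : Type*} [TopologicalSpace X] {x : X} {f : Filter X}
    (h : ¬ ClusterPt x f) : ∀ᶠ y in f, y ≠ x := by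
  rw [clusterPt_iff_frequently] at h
  push Not at h
  obtain ⟨U, hU, hfU⟩ := h
  filter_upwards [hfU] with y hy
  rintro rfl
  exact hy (mem_of_mem_nhds hU)

theorem exists_eventually_lt_of_not_clusterPt {A : Set BinSeq.{u}} {x : BinSeq.{u}} (hA : x ∈ A)
    (hlim : Order.IsSuccLimit x.dom) {f : Filter BinSeq.{u}}
    (h : ¬ @ClusterPt _ (pathTopology A) x f) : ∃ r < x, ∀ᶠ y in f, r < y → x < y := by
  let _ := pathTopology A
  rw [(nhds_basis_pathTopology hA hlim).clusterPt_iff_frequently] at h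
  push Not at h
  simpa using h

section Lindelof

variable {T D : Set BinSeq.{u}} {κ : Ordinal.{u}} {f : Filter BinSeq.{u}}
  (hmem : ∀ᶠ y in f, y ∈ pathClosure T)
  (hf : ∀ x ∈ pathClosure T, ¬ @ClusterPt _ (branchTopology T D) x f)
include hmem hf

theorem eventually_ne (x : BinSeq.{u}) : ∀ᶠ y in f, y ≠ x := by
  let _ := branchTopology T D
  by_cases hx : x ∈ pathClosure T
  · exact eventually_ne_of_not_clusterPt (hf x hx)
  · filter_upwards [hmem] with y hy
    exact ne_of_mem_of_not_mem hy hx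

theorem frequently_le_subset : {s | ∃ᶠ y in f, s ≤ y} ⊆ T := fun s hs => by
  obtain ⟨y, hsy, hy, hne⟩ := (hs.and_eventually (hmem.and (eventually_ne hmem hf s))).exists
  exact hy s (hsy.lt_of_ne' hne)

variable [CountableInterFilter f]

theorem eventually_ge_of_le_isLUB {c : BinSeq.{u}} (hc : IsLUB {s | ∃ᶠ y in f, s ≤ y} c)
    (d : BinSeq.{u}) (hd : d ≤ c) : ∀ᶠ y in f, d ≤ y := by
  induction d using WellFoundedLT.induction with
  | _ d ih =>
  have hlt : ∀ r < d, ∀ᶠ y in f, r < y := fun r hr => by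
    filter_upwards [ih r hr (hr.le.trans hd), eventually_ne hmem hf r] with y hry hne
    exact hry.lt_of_ne' hne
  rcases d.eq_bot_or_snoc_or_isSuccLimit with rfl | ⟨r, i, rfl⟩ | hlim
  · exact .of_forall fun _ => bot_le
  · have hother : ∀ᶠ y in f, ¬ r.snoc (!i) ≤ y := by
      by_contra hfreq
      have hi := (snoc_le_iff.1 (hc.1 hfreq)).2
      exact Bool.not_eq_self i |>.1 (hi.symm.trans (snoc_le_iff.1 hd).2)
    filter_upwards [hlt r (r.lt_snoc i), hother] with y hry hy
    refine snoc_le_iff.2 ⟨hry, ?_⟩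
    by_contra hne
    exact hy (snoc_le_iff.2 ⟨hry, Bool.eq_not.2 hne⟩)
  · by_cases hcc : d.CountablyCofinal
    · obtain ⟨S, hS, hSd, hcof⟩ := hcc
      filter_upwards [(eventually_countable_ball hS).2 fun s hs => hlt s (hSd hs)] with y hy
      refine le_of_forall_lt_le hlim fun r hr => ?_
      obtain ⟨s, hs, hrs⟩ := hcof r hr
      exact hrs.trans (hy s hs).le
    · have hdP : d ∈ pathClosure T := fun r hr => by
        obtain ⟨s, hs, hrs⟩ := exists_lt_of_lt_isLUB hc (hr.trans_le hd)
        obtain ⟨y, hsy, hy⟩ := (hs.and_eventually hmem).exists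
        exact hy r (hrs.trans_le hsy)
      obtain ⟨r, hr, hry⟩ := exists_eventually_lt_of_not_clusterPt (.inl hcc) hlim (hf d hdP)
      filter_upwards [hlt r hr, hry] with y hy h
      exact (h hy).le

variable (hκ : pathClosure T ⊆ binSeqLT κ)
include hκ

theorem not_isChain_frequently_le [f.NeBot] : ¬ IsChain (· ≤ ·) {s | ∃ᶠ y in f, s ≤ y} := by
  intro hchain
  have hbdd : BddAbove (dom '' {s | ∃ᶠ y in f, s ≤ y}) := ⟨κ, forall_mem_image.2 fun s hs => by
    obtain ⟨y, hsy, hy⟩ := (hs.and_eventually hmem).exists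
    exact hsy.1.trans (hκ hy).le⟩
  obtain ⟨c, hc⟩ := exists_isLUB hchain hbdd
  have hsnoc : ∀ i, ∀ᶠ y in f, ¬ c.snoc i ≤ y := fun i => by
    by_contra hfreq
    exact (c.lt_snoc i).not_ge (hc.1 hfreq)
  obtain ⟨y, hcy, hne, hy⟩ := ((eventually_ge_of_le_isLUB hmem hf hc c le_rfl).and
    ((eventually_ne hmem hf c).and (eventually_all.2 hsnoc))).exists
  obtain ⟨i, hi⟩ := exists_snoc_le (hcy.lt_of_ne' hne)
  exact hy i hi

theorem isSplitting_frequently_le : IsSplitting {s | ∃ᶠ y in f, s ≤ y} := by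
  intro t ht
  let _ := branchTopology T D
  have : (f ⊓ 𝓟 (Ici t)).NeBot := frequently_mem_iff_neBot.1 ht
  have hcomp : ∀ s, (∃ᶠ y in f ⊓ 𝓟 (Ici t), s ≤ y) → (∃ᶠ y in f, s ≤ y) ∧ (t ≤ s ∨ s ≤ t) :=
    fun s hs => by
      rw [frequently_inf_principal] at hs
      obtain ⟨y, hty, hsy⟩ := hs.exists
      exact ⟨hs.mono fun _ hy => hy.2, le_total_of_le hty hsy⟩
  have hchain := not_isChain_frequently_le (f := f ⊓ 𝓟 (Ici t)) (hmem.filter_mono inf_le_left)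
    (fun x hx h => hf x hx (h.mono inf_le_left)) hκ
  simp only [IsChain, Set.Pairwise] at hchain
  push Not at hchain
  obtain ⟨p, hp, q, hq, -, hpq⟩ := hchain
  obtain ⟨hpf, hpt⟩ := hcomp p hp
  obtain ⟨hqf, hqt⟩ := hcomp q hq
  have hinc : IncompRel (· ≤ ·) p q := hpq
  exact ⟨fun i => bif i then q else p, Bool.forall_bool.2 ⟨⟨hpf, le_of_incompRel hinc hpt hqt⟩,
    ⟨hqf, le_of_incompRel hinc.symm hqt hpt⟩⟩, hinc⟩

end Lindelof

theorem isLindelof_pathClosure {T D : Set BinSeq.{u}} {κ : Ordinal.{u}} (hT : IsLowerSet T)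
    (hκ : pathClosure T ⊆ binSeqLT κ) (hD : MeetsBinarySystems T D) :
    @IsLindelof _ (branchTopology T D) (pathClosure T) := by
  let _ := branchTopology T D
  intro f _ _ hfP
  by_contra! hf
  have hmem : ∀ᶠ y in f, y ∈ pathClosure T := le_principal_iff.1 hfP
  obtain ⟨δ, C, hC⟩ := (isSplitting_frequently_le hmem hf hκ).exists_isBinarySystem
    ⟨⊥, Frequently.of_forall fun _ => bot_le⟩
  have hCT := hC.mono (frequently_le_subset hmem hf)
  obtain ⟨g, hgD, hgT⟩ := hD δ C hCT
  obtain ⟨r, hr, hry⟩ := exists_eventually_lt_of_not_clusterPt (.inr ⟨hgD, hgT⟩)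
    (hCT.isSuccLimit_dom_limit g) (hf _ (hCT.limit_mem_pathClosure hT g))
  obtain ⟨n, hn⟩ := hCT.exists_lt_of_lt_limit hr
  obtain ⟨y, hny, hy, hlt⟩ := ((hC.mem (res g n)).and_eventually (hmem.and hry)).exists
  exact hgT (hy _ (hlt (hn.trans_le hny)))

/-! ### Trees and their branches -/

section Branches

variable {α : Ordinal.{u}} {T : Set BinSeq.{u}}

theorem IsTreeIn.isLowerSet (hT : IsTreeIn α T) : IsLowerSet T := fun s t hts hs =>
  hT.2 s hs t (hts.1.trans_lt (hT.1 hs)) hts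

theorem IsTreeIn.subset_pathClosure (hT : IsTreeIn α T) : T ⊆ pathClosure T :=
  fun _ hs _ hr => hT.isLowerSet hr.le hs

theorem exists_branch_mk_eq (hT : T ⊆ binSeqLT α) {s : BinSeq.{u}} (hs : s ∈ pathClosure T)
    (hα : α ≤ s.dom) : ∃ B ∈ branches T, #B = lift.{u + 1} α.card := by
  have hr : s.restrict α ≤ s := restrict_le hα
  have hrT : Iio (s.restrict α) ⊆ T := fun t ht => hs t (lt_of_lt_of_le ht hr)
  refine ⟨Subtype.val ⁻¹' Iio (s.restrict α), ⟨?_, fun B hB hsub => hsub.antisymm ?_⟩, ?_⟩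
  · exact fun t ht t' ht' _ => le_total_of_le (le_of_lt ht) (le_of_lt ht')
  · intro t ht
    have hlt : (s.restrict α).restrict t.1.dom < s.restrict α := restrict_lt (hT t.2)
    have heq : t.1 = (s.restrict α).restrict t.1.dom :=
      (hB.total ht (hsub (a := ⟨_, hrT hlt⟩) hlt)).elim (fun h => eq_of_dom_eq h le_rfl rfl)
        fun h => eq_of_dom_eq le_rfl h rfl
    exact heq.trans_lt hlt
  · rw [mk_preimage_of_injective_of_subset_range _ _ Subtype.val_injective (by simpa using hrT),
      mk_Iio]
    rfl

theorem pathClosure_subset_of_forall_branch (hT : T ⊆ binSeqLT α)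
    (hbranch : ∀ B ∈ branches T, #B ≠ lift.{u + 1} α.card) : pathClosure T ⊆ binSeqLT α := by
  intro s hs
  by_contra hα
  obtain ⟨B, hB, hcard⟩ := exists_branch_mk_eq hT hs (not_lt.1 hα)
  exact hbranch B hB hcard

theorem IsTreeIn.exists_branch_eq (hT : IsTreeIn α T) {B : Set T} (hB : B ∈ branches T) :
    ∃ c ∈ pathClosure T, B = {t | t.1 ≤ c} := by
  obtain ⟨c, hc⟩ := exists_isLUB (S := Subtype.val '' B)
    (by rintro _ ⟨s, hs, rfl⟩ _ ⟨t, ht, rfl⟩ -; exact hB.1.total hs ht)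
    ⟨α, by rintro _ ⟨_, ⟨s, -, rfl⟩, rfl⟩; exact (hT.1 s.2).le⟩
  refine ⟨c, fun r hr => ?_, hB.2 ?_ fun t ht => hc.1 (mem_image_of_mem _ ht)⟩
  · obtain ⟨_, ⟨s, -, rfl⟩, hrs⟩ := exists_lt_of_lt_isLUB hc hr
    exact hT.isLowerSet hrs.le s.2
  · exact fun s hs t ht _ => le_total_of_le hs ht

theorem IsTreeIn.mk_branches_le (hT : IsTreeIn α T) : #(branches T) ≤ #(pathClosure T) := by
  choose c hc hBc using fun B : branches T => hT.exists_branch_eq B.2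
  refine mk_le_of_injective (f := fun B => ⟨c B, hc B⟩) fun B B' h => Subtype.ext ?_
  have hcc : c B = c B' := congrArg Subtype.val h
  rw [hBc B, hBc B', hcc]

end Branches

section Spaces

variable {X : Type u} {T D : Set BinSeq.{u}} {b : X → BinSeq.{u}}

theorem isZeroDimT1Lindelof_induced {κ : Ordinal.{u}} (hT : IsLowerSet T)
    (hκ : pathClosure T ⊆ binSeqLT κ) (hD : MeetsBinarySystems T D) (hb : Function.Injective b)
    (hrange : range b = pathClosure T) :
    IsZeroDimT1Lindelof ((branchTopology T D).induced b) := by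
  let _ := branchTopology T D
  let _ := (branchTopology T D).induced b
  have hind : Topology.IsInducing b := ⟨rfl⟩
  have := t1Space_pathTopology ({x | ¬ x.CountablyCofinal} ∪ D \ T)
  refine ⟨(isZeroDimensional_pathTopology _).induced b,
    t1Space_of_injective_of_continuous hb hind.continuous, ⟨hind.isLindelof_iff.2 ?_⟩⟩
  rw [image_univ, hrange]
  exact isLindelof_pathClosure hT hκ hD

open Classical in
theorem pointCharacter_induced_branchTopology (hT : IsLowerSet T)
    (hω : pathClosure T ⊆ binSeqLT (Ordinal.omega 2)) (hrange : range b = pathClosure T) (x : X) :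
    pointCharacter ((branchTopology T D).induced b) x =
      if (b x).CountablyCofinal then ℵ₀ else ℵ_ 1 := by
  have hbx : b x ∈ pathClosure T := hrange ▸ mem_range_self x
  split_ifs with hx
  · exact pointCharacter_of_countablyCofinal hx
  · exact pointCharacter_of_not_countablyCofinal hx (.inl hx)
      (fun r hr => hrange ▸ fun s hs => hT hs.le (hbx r hr)) (hω hbx)

theorem IsZeroDimT1Lindelof.isRegularT1LindelofCharLE (hT : IsLowerSet T)
    (hω : pathClosure T ⊆ binSeqLT (Ordinal.omega 2)) (hrange : range b = pathClosure T)
    (h : IsZeroDimT1Lindelof ((branchTopology T D).induced b)) :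
    IsRegularT1LindelofCharLE ((branchTopology T D).induced b) where
  regular := regularSpace_of_isZeroDimensional h.zeroDim
  t1 := h.t1
  lindelof := h.lindelof
  character_le := ciSup_le' fun x => by
    rw [pointCharacter_induced_branchTopology hT hω hrange]
    split_ifs
    exacts [aleph0_le_aleph 1, le_rfl]

theorem exists_isOpen_inter_eq_singleton (hb : Function.Injective b) {x : X}
    (hx : (b x).CountablyCofinal) :
    ∃ O₀ O₁ : Set X, IsOpen[(branchTopology T D).induced b] O₀ ∧
      IsOpen[(branchTopology T Dᶜ).induced b] O₁ ∧ O₀ ∩ O₁ = {x} := by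
  have hsingleton : ∀ E : Set BinSeq.{u}, b x ∉ E →
      IsOpen[(branchTopology T E).induced b] {x} := fun E hE =>
    ⟨{b x}, isOpen_singleton_pathTopology fun h =>
      absurd h (not_or_intro (not_not_intro hx) fun h => hE h.1),
      by
        ext y; exact hb.eq_iff⟩
  by_cases hD : b x ∈ D
  · exact ⟨univ, {x}, @isOpen_univ _ (_), hsingleton Dᶜ (not_not_intro hD), univ_inter _⟩
  · exact ⟨{x}, univ, hsingleton D hD, @isOpen_univ _ (_), inter_univ _⟩

theorem modificationHypotheses_induced (hT : IsLowerSet T)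
    (hω : pathClosure T ⊆ binSeqLT (Ordinal.omega 2)) (hb : Function.Injective b)
    (hrange : range b = pathClosure T) (hcard : 𝔠 < #X)
    (h : IsZeroDimT1Lindelof ((branchTopology T univ).induced b))
    (h₀ : IsZeroDimT1Lindelof ((branchTopology T D).induced b))
    (h₁ : IsZeroDimT1Lindelof ((branchTopology T Dᶜ).induced b)) :
    ModificationHypotheses ((branchTopology T univ).induced b) ((branchTopology T D).induced b)
      ((branchTopology T Dᶜ).induced b) := by
  have hchar := fun E => pointCharacter_induced_branchTopology (D := E) hT hω hrange
  have hfiner : ∀ E, (branchTopology T E).induced b ≤ (branchTopology T univ).induced b := fun E =>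
    induced_mono (pathTopology_mono (union_subset_union_right _
      (sdiff_subset_sdiff_left (subset_univ E))))
  refine ⟨?_, h.lindelof, hcard, h₀.isRegularT1LindelofCharLE hT hω hrange,
    h₁.isRegularT1LindelofCharLE hT hω hrange, hfiner D, hfiner Dᶜ,
    fun x => (hchar D x).trans (hchar Dᶜ x).symm, fun x hx _ => ?_, fun x hx _ => ?_⟩
  · let _ := (branchTopology T univ).induced b
    have := h.t1
    have := regularSpace_of_isZeroDimensional h.zeroDim
    infer_instance
  · have hcc : ¬ (b x).CountablyCofinal := fun hcc =>
      aleph0_lt_aleph_one.ne (by rwa [hchar, if_pos hcc] at hx)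
    have hxT : b x ∈ pathClosure T := hrange ▸ mem_range_self x
    obtain ⟨e, he⟩ := exists_enumeration_Iio hcc (hω hxT)
    exact ⟨_, isShrinkingClopenSeq_induced hb hxT hcc he⟩
  · refine exists_isOpen_inter_eq_singleton hb (by_contra fun hcc => ?_)
    exact aleph0_lt_aleph_one.ne' (by rwa [hchar, if_neg hcc] at hx)

end Spaces

theorem exists_injective_range_eq {α : Type v} (S : Set α) [Small.{u} S] :
    ∃ (X : Type u) (b : X → α), Function.Injective b ∧ range b = S :=
  ⟨Shrink.{u} S, Subtype.val ∘ (equivShrink S).symm,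
    Subtype.val_injective.comp (equivShrink S).symm.injective, by
      rw [range_comp, (equivShrink S).symm.range_eq_univ, image_univ, Subtype.range_coe]⟩

theorem IsBinarySystem.card_le_continuum {T : Set BinSeq.{u}} {δ : Ordinal.{u}}
    {C : List Bool → BinSeq.{u}} (hC : IsBinarySystem T δ C) (hT : IsLowerSet T)
    (hω : pathClosure T ⊆ binSeqLT (Ordinal.omega 2)) : δ.card ≤ 𝔠 := by
  have hδ : (hC.limit fun _ => false).dom < Ordinal.omega 2 := hω (hC.limit_mem_pathClosure hT _)
  rw [hC.dom_limit] at hδ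
  exact (card_le_aleph_one_of_lt_omega_two hδ).trans aleph_one_le_continuum

theorem proposition3p1_general
    (T : Set BinSeq.{u})
    (hT : IsTreeIn (Ordinal.omega 2) T)
    (hlevel : ∀ β : Ordinal.{u}, #(treeLevel T β) ≤ 𝔠)
    (hbranch : ∀ B ∈ branches T, #B ≠ ℵ_ 2)
    (hlarge : 𝔠 < #T ∨ 𝔠 < #(branches T))
    (hcantor : ¬ ContainsCantorTree T) :
    ∃ (X : Type u) (τ τ₀ τ₁ : TopologicalSpace X),
      IsZeroDimT1Lindelof τ ∧ IsZeroDimT1Lindelof τ₀ ∧ IsZeroDimT1Lindelof τ₁ ∧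
      ModificationHypotheses τ τ₀ τ₁ := by
  have hlow := hT.isLowerSet
  have hω : pathClosure T ⊆ binSeqLT (Ordinal.omega 2) :=
    pathClosure_subset_of_forall_branch hT.1 (by simpa using hbranch)
  have := small_subset hω
  obtain ⟨X, b, hb, hrange⟩ := exists_injective_range_eq.{u} (pathClosure T)
  obtain ⟨D, hD₀, hD₁⟩ := exists_meetsBinarySystems_compl hlevel hcantor
    fun δ C hC => hC.card_le_continuum hlow hω
  have hcard : 𝔠 < #X := by
    rw [← lift_lt.{u, u + 1}, lift_continuum, ← mk_range_eq_of_injective hb,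
      lift_id'.{u, u + 1}, hrange]
    exact hlarge.elim (·.trans_le (mk_le_mk_of_subset hT.subset_pathClosure))
      (·.trans_le hT.mk_branches_le)
  have h := isZeroDimT1Lindelof_induced hlow hω (hD₀.mono (subset_univ D)) hb hrange
  have h₀ := isZeroDimT1Lindelof_induced hlow hω hD₀ hb hrange
  have h₁ := isZeroDimT1Lindelof_induced hlow hω hD₁ hb hrange
  exact ⟨X, _, _, _, h, h₀, h₁, modificationHypotheses_induced hlow hω hb hrange hcard h h₀ h₁⟩

theorem proposition3p1
    (hCH : (𝔠 : Cardinal.{u}) = ℵ_ 1)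
    (T : Set BinSeq.{u})
    (hT : IsTreeIn (Ordinal.omega 2) T)
    (hlevel : ∀ β : Ordinal.{u}, #(treeLevel T β) ≤ ℵ_ 1)
    (hbranch : ∀ B ∈ branches T, #B ≠ ℵ_ 2)
    (hlarge : 𝔠 < #T ∨ 𝔠 < #(branches T))
    (hcantor : ¬ ContainsCantorTree T) :
    ∃ (X : Type u) (τ τ₀ τ₁ : TopologicalSpace X),
      IsZeroDimT1Lindelof τ ∧ IsZeroDimT1Lindelof τ₀ ∧ IsZeroDimT1Lindelof τ₁ ∧
      ModificationHypotheses τ τ₀ τ₁ :=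
  proposition3p1_general T hT (fun β => (hlevel β).trans aleph_one_le_continuum) hbranch hlarge
    hcantor
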